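/- Let $G$ be a nonabelian group (finite or infinite). Let $BNC(G)$ be the simplicial complex whose vertices are the noncentral elements of $G$ and whose simplices are the nonempty finite sets of noncentral elements of $G$ which pairwise do not commute. Then: (1) the conjugation action of $G$ on its elements maps simplices of $BNC(G)$ to simplices of $BNC(G)$, so that $BNC(G)$ is a $G$-simplicial complex; (2) any two vertices of $BNC(G)$ are joined by an edge path consisting of at most two edges of $BNC(G)$; (3) the geometric realization of $BNC(G)$ (with the weak topology, which is the usual Euclidean one if $G$ is finite) is path-connected; (4) this geometric realization is simply connected. -/

import Mathlib

namespace NonCommuting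

/-! ### Simplicial complexes, their realizations and their edge graphs -/

section Complexes

variable {V : Type*}

/-- The closed simplex spanned by a finite set `s` of vertices, in barycentric coordinates:
the functions `x : V → ℝ` which are nonnegative, vanish outside `s`, and have sum `1` over `s`. -/
def closedSimplex (s : Finset V) : Set (V → ℝ) :=
  {x | (∀ v, 0 ≤ x v) ∧ (∀ v, v ∉ s → x v = 0) ∧ ∑ v ∈ s, x v = 1}

/-- The set underlying the geometric realization of `K`: the union of the closed simplices
spanned by the faces of `K`. -/
def Realization (K : PreAbstractSimplicialComplex V) : Type _ :=
  {x : V → ℝ // ∃ s ∈ K.faces, x ∈ closedSimplex s}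

/-- The inclusion of the closed simplex of a face into the realization. -/
def faceInclusion (K : PreAbstractSimplicialComplex V) (s : K.faces) :
    closedSimplex (s : Finset V) → Realization K :=
  fun x => ⟨x.1, s.1, s.2, x.2⟩

/-- The weak (coherent) topology: a subset of the realization is open if and only if its trace on
the closed simplex of every face is open, where a closed simplex carries its Euclidean topology
(the topology of coordinatewise convergence). For a finite complex this is the usual topology. -/
instance realizationTopology (K : PreAbstractSimplicialComplex V) :
    TopologicalSpace (Realization K) :=
  ⨆ s : K.faces, TopologicalSpace.coinduced (faceInclusion K s) inferInstance

/-- The vertices of `K`. -/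
def vertexSet (K : PreAbstractSimplicialComplex V) : Set V :=
  {v | {v} ∈ K.faces}

open Classical in
/-- The graph formed by the vertices and the edges (the `1`-simplices) of `K`; its walks are the
edge paths in `K`. -/
def edgeGraph (K : PreAbstractSimplicialComplex V) : SimpleGraph (vertexSet K) where
  Adj v w := v ≠ w ∧ ({(v : V), (w : V)} : Finset V) ∈ K.faces
  symm := ⟨fun _ _ h => ⟨h.1.symm, by rw [Finset.pair_comm]; exact h.2⟩⟩
  loopless := ⟨fun _ h => h.1 rfl⟩

/-- The action of `H` on `V` makes `K` an `H`-simplicial complex: every element of `H` maps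
simplices of `K` to simplices of `K`. -/
def IsSimplicialAction (H : Type*) [Group H] [MulAction H V]
    (K : PreAbstractSimplicialComplex V) : Prop :=
  ∀ h : H, ∀ s ∈ K.faces, s.map (MulAction.toPerm h).toEmbedding ∈ K.faces

end Complexes

/-! ### Non-commuting complexes -/

section Groups

variable (G : Type*) [Group G]

/-- The complex `NC(G)`: its simplices are the nonempty finite sets of nontrivial elements of `G`
which pairwise do not commute. -/
def NC : PreAbstractSimplicialComplex G where
  faces := {s | s.Nonempty ∧ (∀ g ∈ s, g ≠ 1) ∧
    ∀ g ∈ s, ∀ h ∈ s, g ≠ h → ¬ Commute g h}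
  isRelLowerSet_faces := fun _ hs =>
    ⟨hs.1, fun _ hts ht => ⟨ht, fun g hg => hs.2.1 g (hts hg),
      fun g hg h hh => hs.2.2 g (hts hg) h (hts hh)⟩⟩

/-- The complex `BNC(G)`: the subcomplex of `NC(G)` consisting of the simplices all of whose
vertices are noncentral elements of `G`. -/
def BNC : PreAbstractSimplicialComplex G where
  faces := {s | s ∈ (NC G).faces ∧ ∀ g ∈ s, g ∉ Subgroup.center G}
  isRelLowerSet_faces := fun _ hs =>
    ⟨hs.1.1, fun _ hts ht => ⟨((NC G).isRelLowerSet_faces hs.1).2 hts ht,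
      fun g hg => hs.2 g (hts hg)⟩⟩

end Groups

end NonCommuting

namespace NonCommuting

open Path unitInterval

/-! ### Homotopy of paths in a realization -/

section Realizations

variable {V : Type*} {K : PreAbstractSimplicialComplex V}

/-! ### Simplices of the realization -/

/-! Centralizers are subgroups: if exactly one of two elements commutes with `c`, their product does
not. Hence two noncentral elements have a common noncommuting neighbour (`exists_not_commute_both`),
giving edge paths of length at most two. The same trick applied to an edge path `a, b, c, d` shows
that one of `b`, `c`, `b * c` is equal or adjacent to all four vertices (`exists_near_path`), so
squares and pentagons of edges are null-homotopic (`edgeClass_square`, `edgeClass_pentagon`).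

Choosing a path of length at most two from a base vertex to each vertex, every edge closes a
pentagon, so the chosen classes are compatible along edges. By `simplyConnectedSpace_of_classes`
this suffices: the classes extend to all points, and since open stars are contractible and cover the
space, every path carries the class at its start to the class at its end. -/

theorem convex_closedSimplex (s : Finset V) : Convex ℝ (closedSimplex s) := by
  intro x hx y hy a b ha hb hab
  refine ⟨fun v => ?_, fun v hv => ?_, ?_⟩
  · have := hx.1 v
    have := hy.1 v
    simp only [Pi.add_apply, Pi.smul_apply, smul_eq_mul]
    positivity
  · simp [hx.2.1 v hv, hy.2.1 v hv]
  · simp [Finset.sum_add_distrib, ← Finset.mul_sum, hx.2.2, hy.2.2, hab]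

theorem mem_of_pos {s : Finset V} {x : V → ℝ} (hx : x ∈ closedSimplex s) {v : V} (hv : 0 < x v) :
    v ∈ s := by
  by_contra h
  exact hv.ne' (hx.2.1 v h)

theorem exists_pos {s : Finset V} {x : V → ℝ} (hx : x ∈ closedSimplex s) : ∃ v, 0 < x v := by
  by_contra! h
  have := Finset.sum_nonpos fun v (_ : v ∈ s) => h v
  rw [hx.2.2] at this
  norm_num at this

theorem continuous_faceInclusion (s : K.faces) : Continuous (faceInclusion K s) :=
  continuous_iSup_rng (i := s) continuous_coinduced_rng

theorem isOpen_realization_iff {U : Set (Realization K)} :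
    IsOpen U ↔ ∀ s : K.faces, IsOpen (faceInclusion K s ⁻¹' U) := by
  simp only [isOpen_iSup_iff, isOpen_coinduced]

/-- A map on an open subset of the realization is continuous if it is so on every face. -/
theorem continuous_of_isOpen {Y : Type*} [TopologicalSpace Y] {U : Set (Realization K)}
    (hU : IsOpen U) (f : U → Y)
    (h : ∀ s : K.faces,
      Continuous fun x : faceInclusion K s ⁻¹' U => f ⟨faceInclusion K s x, x.2⟩) :
    Continuous f := by
  refine continuous_def.2 fun W hW => ?_
  rw [hU.isOpenEmbedding_subtypeVal.isOpen_iff_image_isOpen, isOpen_realization_iff]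
  intro s
  have hs := (hU.preimage (continuous_faceInclusion s)).isOpenMap_subtype_val _
    (hW.preimage (h s))
  convert! hs using 1
  ext x
  simp

/-! ### Segments -/

/-- Two points of the realization lie in a common closed simplex. -/
def Cofacial (x y : Realization K) : Prop :=
  ∃ s ∈ K.faces, x.1 ∈ closedSimplex s ∧ y.1 ∈ closedSimplex s

theorem Cofacial.symm {x y : Realization K} (h : Cofacial x y) : Cofacial y x :=
  let ⟨s, hs, hx, hy⟩ := h
  ⟨s, hs, hy, hx⟩

theorem lineMap_mem_closedSimplex {s : Finset V} {x y : V → ℝ} (hx : x ∈ closedSimplex s)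
    (hy : y ∈ closedSimplex s) (t : I) :
    ((1 - t : ℝ) • x + (t : ℝ) • y) ∈ closedSimplex s :=
  convex_closedSimplex s hx hy (one_minus_nonneg t) (nonneg t) (by ring)

/-- The straight path between two points of a closed simplex. -/
def simplexSegment {s : Finset V} (x y : closedSimplex s) : Path x y where
  toFun t := ⟨(1 - t : ℝ) • x.1 + (t : ℝ) • y.1, lineMap_mem_closedSimplex x.2 y.2 t⟩
  continuous_toFun := by fun_prop
  source' := by simp
  target' := by simp

/-- The straight path between two points of a common closed simplex of the realization. -/
def segmentPath {x y : Realization K} (h : Cofacial x y) : Path x y where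
  toFun t := ⟨(1 - t : ℝ) • x.1 + (t : ℝ) • y.1,
    let ⟨s, hs, hx, hy⟩ := h
    ⟨s, hs, lineMap_mem_closedSimplex hx hy t⟩⟩
  continuous_toFun := by
    obtain ⟨s, hs, hx, hy⟩ := h
    exact (continuous_faceInclusion ⟨s, hs⟩).comp (simplexSegment ⟨x.1, hx⟩ ⟨y.1, hy⟩).continuous
  source' := Subtype.ext (by simp)
  target' := Subtype.ext (by simp)

/-- The homotopy class of the straight path between two points of a common closed simplex. -/
def segmentClass {x y : Realization K} (h : Cofacial x y) : Homotopic.Quotient x y :=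
  .mk (segmentPath h)

/-- All paths with given endpoints become homotopic under a map from a simply connected space. -/
theorem map_homotopic_of_simplyConnected {A X : Type*} [TopologicalSpace A] [TopologicalSpace X]
    [SimplyConnectedSpace A] {f : A → X} (hf : Continuous f) {a b : A} (p q : Path a b) :
    (p.map hf).Homotopic (q.map hf) :=
  (SimplyConnectedSpace.paths_homotopic p q).map ⟨f, hf⟩

theorem segmentClass_trans {x y z : Realization K} {s : Finset V} (hs : s ∈ K.faces)
    (hx : x.1 ∈ closedSimplex s) (hy : y.1 ∈ closedSimplex s) (hz : z.1 ∈ closedSimplex s)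
    (hxy : Cofacial x y) (hyz : Cofacial y z) (hxz : Cofacial x z) :
    (segmentClass hxy).trans (segmentClass hyz) = segmentClass hxz := by
  have : ContractibleSpace (closedSimplex s) :=
    (convex_closedSimplex s).contractibleSpace ⟨_, hx⟩
  have hf := continuous_faceInclusion (K := K) ⟨s, hs⟩
  have key := map_homotopic_of_simplyConnected hf
    ((simplexSegment ⟨x.1, hx⟩ ⟨y.1, hy⟩).trans (simplexSegment ⟨y.1, hy⟩ ⟨z.1, hz⟩))
    (simplexSegment ⟨x.1, hx⟩ ⟨z.1, hz⟩)
  rw [Path.map_trans] at key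
  exact Homotopic.Quotient.eq.2 key

theorem segmentClass_self {x : Realization K} (h : Cofacial x x) :
    segmentClass h = Homotopic.Quotient.refl x := by
  obtain ⟨s, hs, hx, _⟩ := id h
  have := segmentClass_trans hs hx hx hx h h h
  -- An idempotent in a groupoid is an identity.
  calc segmentClass h
      = (segmentClass h).symm.trans ((segmentClass h).trans (segmentClass h)) := by
        rw [← Homotopic.Quotient.trans_assoc, Homotopic.Quotient.symm_trans, Homotopic.Quotient.refl_trans]
    _ = Homotopic.Quotient.refl x := by rw [this, Homotopic.Quotient.symm_trans]

theorem segmentClass_symm {x y : Realization K} (h : Cofacial x y) :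
    segmentClass h.symm = (segmentClass h).symm := by
  obtain ⟨s, hs, hx, hy⟩ := id h
  have hxx : Cofacial x x := ⟨s, hs, hx, hx⟩
  have := segmentClass_trans hs hx hy hx h h.symm hxx
  rw [segmentClass_self] at this
  rw [← Homotopic.Quotient.refl_trans (segmentClass h.symm), ← Homotopic.Quotient.symm_trans (segmentClass h),
    Homotopic.Quotient.trans_assoc, this, Homotopic.Quotient.trans_refl]

/-! ### Vertices and their open stars -/

open Classical in
theorem single_mem_closedSimplex {s : Finset V} {v : V} (hv : v ∈ s) :
    (Pi.single v 1 : V → ℝ) ∈ closedSimplex s := by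
  refine ⟨fun w => ?_, fun w hw => ?_, ?_⟩
  · by_cases h : w = v
    · subst h; simp
    · simp [h]
  · rw [Pi.single_eq_of_ne]
    rintro rfl
    exact hw hv
  · simp [hv]

open Classical in
/-- A vertex as a point of the realization. -/
noncomputable def vertexPoint (v : vertexSet K) : Realization K :=
  ⟨Pi.single v.1 1, {v.1}, v.2, single_mem_closedSimplex (Finset.mem_singleton_self _)⟩

theorem vertexPoint_mem {s : Finset V} {v : vertexSet K} (hv : v.1 ∈ s) :
    (vertexPoint v).1 ∈ closedSimplex s :=
  single_mem_closedSimplex hv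

/-- The open star of a vertex. -/
def openStar (K : PreAbstractSimplicialComplex V) (v : V) : Set (Realization K) :=
  {x | 0 < x.1 v}

theorem isOpen_openStar (v : V) : IsOpen (openStar K v) := by
  rw [isOpen_realization_iff]
  intro s
  exact isOpen_lt continuous_const ((continuous_apply v).comp continuous_subtype_val)

open Classical in
theorem vertexPoint_mem_openStar (v : vertexSet K) : vertexPoint v ∈ openStar K v := by
  change 0 < (Pi.single v.1 1 : V → ℝ) v.1
  simp

theorem cofacial_of_mem_openStar {v : vertexSet K} {x : Realization K} (hx : x ∈ openStar K v) :
    Cofacial x (vertexPoint v) := by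
  obtain ⟨s, hs, hxs⟩ := x.2
  exact ⟨s, hs, hxs, vertexPoint_mem (mem_of_pos hxs hx)⟩

theorem mem_vertexSet_of_pos {v : V} {x : Realization K} (hx : 0 < x.1 v) : v ∈ vertexSet K := by
  obtain ⟨s, hs, hxs⟩ := x.2
  exact (K.isRelLowerSet_faces hs).2 (Finset.singleton_subset_iff.2 (mem_of_pos hxs hx))
    (Finset.singleton_nonempty v)

theorem segmentPath_mem_openStar {v : vertexSet K} {x y : Realization K} (h : Cofacial x y)
    (hx : x ∈ openStar K v) (hy : y ∈ openStar K v) (t : I) : segmentPath h t ∈ openStar K v :=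
  (convex_Ioi (0 : ℝ)) hx hy (one_minus_nonneg t) (nonneg t) (by ring)

/-- Straight-line contraction to the vertex: any face containing a point of the star contains the
vertex. -/
theorem contractibleSpace_openStar (v : vertexSet K) : ContractibleSpace (openStar K v) := by
  -- The homotopy is curried: the weak topology tests continuity face by face on the star itself,
  -- but not directly on its product with `I`.
  let F : openStar K v → C(I, Realization K) :=
    fun x => (segmentPath (cofacial_of_mem_openStar x.2)).toContinuousMap
  have hF : Continuous F := by
    refine continuous_of_isOpen (isOpen_openStar _) F fun s => ?_
    refine ContinuousMap.continuous_of_continuous_uncurry _ ?_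
    let g : (faceInclusion K s ⁻¹' openStar K v) × I → closedSimplex s.1 := fun p =>
      ⟨(1 - p.2 : ℝ) • p.1.1.1 + (p.2 : ℝ) • (vertexPoint v).1,
        lineMap_mem_closedSimplex p.1.1.2 (vertexPoint_mem (mem_of_pos p.1.1.2 p.1.2)) p.2⟩
    have hg : Continuous g := by fun_prop
    exact (continuous_faceInclusion s).comp hg
  have hF' : Continuous fun p : I × openStar K v => F p.2 p.1 := by fun_prop
  refine (contractible_iff_id_nullhomotopic _).2 ⟨⟨_, vertexPoint_mem_openStar v⟩, ⟨{
    toFun := fun p => ⟨F p.2 p.1, segmentPath_mem_openStar _ p.2.2 (vertexPoint_mem_openStar v) _⟩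
    continuous_toFun := hF'.subtype_mk _
    map_zero_left := fun x => Subtype.ext (segmentPath _).source
    map_one_left := fun x => Subtype.ext (segmentPath _).target }⟩⟩

/-- A path in the open star of `v` is homotopic to the path through `v`. -/
theorem mk_eq_of_mem_openStar {v : vertexSet K} {x y : Realization K} (γ : Path x y)
    (hγ : ∀ t, γ t ∈ openStar K v) (hx : x ∈ openStar K v) (hy : y ∈ openStar K v) :
    Homotopic.Quotient.mk γ = (segmentClass (cofacial_of_mem_openStar hx)).trans
      (segmentClass (cofacial_of_mem_openStar hy).symm) := by
  have := contractibleSpace_openStar v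
  have hv := vertexPoint_mem_openStar v
  let p : Path (⟨x, hx⟩ : openStar K v) ⟨y, hy⟩ :=
    { toFun := fun t => ⟨γ t, hγ t⟩
      source' := Subtype.ext γ.source
      target' := Subtype.ext γ.target }
  let q : Path (⟨x, hx⟩ : openStar K v) ⟨vertexPoint v, hv⟩ :=
    { toFun := fun t => ⟨segmentPath _ t,
        segmentPath_mem_openStar (cofacial_of_mem_openStar hx) hx hv t⟩
      source' := Subtype.ext (segmentPath _).source
      target' := Subtype.ext (segmentPath _).target }
  let r : Path (⟨vertexPoint v, hv⟩ : openStar K v) ⟨y, hy⟩ :=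
    { toFun := fun t => ⟨segmentPath _ t,
        segmentPath_mem_openStar (cofacial_of_mem_openStar hy).symm hv hy t⟩
      source' := Subtype.ext (segmentPath _).source
      target' := Subtype.ext (segmentPath _).target }
  have key := map_homotopic_of_simplyConnected continuous_subtype_val p (q.trans r)
  rw [Path.map_trans] at key
  exact Homotopic.Quotient.eq.2 key

/-! ### A criterion for simple connectedness -/

theorem Cofacial.of_mem_face {s : Finset V} (hs : s ∈ K.faces) {v w : vertexSet K}
    (hv : v.1 ∈ s) (hw : w.1 ∈ s) : Cofacial (vertexPoint v) (vertexPoint w) :=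
  ⟨s, hs, vertexPoint_mem hv, vertexPoint_mem hw⟩

/-- The realization is simply connected if there are homotopy classes of paths from a base point
to all vertices which are compatible along the edges. -/
theorem simplyConnectedSpace_of_classes (b : Realization K)
    (κ : ∀ v : vertexSet K, Homotopic.Quotient b (vertexPoint v))
    (hκ : ∀ (v w : vertexSet K) (h : Cofacial (vertexPoint v) (vertexPoint w)),
      (κ v).trans (segmentClass h) = κ w) :
    SimplyConnectedSpace (Realization K) := by
  have hpos : ∀ x : Realization K, ∃ v : vertexSet K, x ∈ openStar K v := fun x =>
    let ⟨_, _, hs⟩ := x.2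
    let ⟨v, hv⟩ := exists_pos hs
    ⟨⟨v, mem_vertexSet_of_pos hv⟩, hv⟩
  choose c hc using hpos
  -- The class at `x` goes through a vertex whose open star contains `x`; compatibility along edges
  -- makes the choice irrelevant.
  let Φ : ∀ x : Realization K, Homotopic.Quotient b x := fun x =>
    (κ (c x)).trans (segmentClass (cofacial_of_mem_openStar (hc x)).symm)
  have hΦ : ∀ (x : Realization K) (v : vertexSet K) (hx : x ∈ openStar K v),
      Φ x = (κ v).trans (segmentClass (cofacial_of_mem_openStar hx).symm) := by
    intro x v hx
    obtain ⟨s, hs, hxs⟩ := x.2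
    have hcs := mem_of_pos hxs (hc x)
    have hvs := mem_of_pos hxs hx
    have hcv := Cofacial.of_mem_face hs hcs hvs
    rw [← hκ (c x) v hcv, Homotopic.Quotient.trans_assoc, segmentClass_trans hs (vertexPoint_mem hcs)
      (vertexPoint_mem hvs) hxs hcv _ (cofacial_of_mem_openStar (hc x)).symm]
  have hstar : ∀ (v : vertexSet K) (x y : Realization K) (γ : Path x y),
      (∀ t, γ t ∈ openStar K v) → (Φ x).trans (.mk γ) = Φ y := by
    intro v x y γ hγ
    have hx : x ∈ openStar K v := by simpa using hγ 0
    have hy : y ∈ openStar K v := by simpa using hγ 1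
    rw [hΦ x v hx, hΦ y v hy, mk_eq_of_mem_openStar γ hγ hx hy,
      segmentClass_symm (cofacial_of_mem_openStar hx),
      Homotopic.Quotient.trans_assoc, ← Homotopic.Quotient.trans_assoc (Homotopic.Quotient.symm _), Homotopic.Quotient.symm_trans,
      Homotopic.Quotient.refl_trans]
  have hpath : ∀ (x y : Realization K) (γ : Path x y), (Φ x).trans (.mk γ) = Φ y := by
    intro x y γ
    -- Lebesgue subdivision: each piece of `γ` stays in one open star.
    obtain ⟨t, ht0, htm, ⟨n, hn⟩, htc⟩ :=
      exists_monotone_Icc_subset_open_cover_unitInterval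
        (c := fun v : vertexSet K => γ ⁻¹' openStar K v)
        (fun v => (isOpen_openStar v.1).preimage γ.continuous)
        (fun s _ => Set.mem_iUnion.2 ⟨c (γ s), hc (γ s)⟩)
    have hsub : ∀ m, (Φ (γ (t 0))).trans (.mk (γ.subpath (t 0) (t m))) = Φ (γ (t m)) := by
      intro m
      induction m with
      | zero => simp
      | succ m ih =>
        obtain ⟨v, hv⟩ := htc m
        have hm := hstar v _ _ (γ.subpath (t m) (t (m + 1))) fun u => by
          have hu : γ.subpath (t m) (t (m + 1)) u ∈ γ '' Set.Icc (t m) (t (m + 1)) := by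
            rw [← Path.range_subpath_of_le _ _ _ (htm m.le_succ)]
            exact ⟨u, rfl⟩
          obtain ⟨w, hw, hwu⟩ := hu
          rw [← hwu]
          exact hv hw
        rw [← hm, ← ih, Homotopic.Quotient.trans_assoc (Φ _), ← Homotopic.Quotient.mk_trans,
          Homotopic.Quotient.eq.2 ⟨Path.Homotopy.subpathTransSubpath γ _ _ _⟩]
    have h1 := hsub n
    rw [ht0, hn n le_rfl, Path.subpath_zero_one] at h1
    -- The endpoints `γ 0` and `x` agree only propositionally, hence the transport.
    have hcast : ∀ (x' y' : Realization K) (hx : x' = x) (hy : y' = y),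
        (Φ x').trans (.mk (γ.cast hx hy)) = Φ y' → (Φ x).trans (.mk γ) = Φ y := by
      rintro x' y' rfl rfl h
      exact h
    exact hcast _ _ γ.source γ.target h1
  refine (simply_connected_iff_unique_homotopic _).2
    ⟨⟨b⟩, fun x y => ⟨⟨⟨(Φ x).symm.trans (Φ y)⟩, ?_⟩⟩⟩
  intro γ
  obtain ⟨γ, rfl⟩ := Homotopic.Quotient.mk_surjective γ
  change _ = (Φ x).symm.trans (Φ y)
  rw [← hpath x y γ, ← Homotopic.Quotient.trans_assoc, Homotopic.Quotient.symm_trans, Homotopic.Quotient.refl_trans]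

end Realizations


/-! ### Noncommuting graphs and short cycles -/

section NonCommutingGroups

variable {G : Type*} [Group G]

theorem not_commute_mul_left {a b c : G} (ha : ¬ Commute a c) (hb : Commute b c) :
    ¬ Commute (a * b) c := fun h => ha (by simpa using h.mul_left hb.inv_left)

theorem not_commute_mul_right {a b c : G} (ha : Commute a c) (hb : ¬ Commute b c) :
    ¬ Commute (a * b) c := fun h => hb (by simpa using ha.inv_left.mul_left h)

theorem notMem_center_of_not_commute {a b : G} (h : ¬ Commute a b) : a ∉ Subgroup.center G :=
  fun ha => h (Subgroup.mem_center_iff.1 ha b).symm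

theorem exists_not_commute {a : G} (h : a ∉ Subgroup.center G) : ∃ b, ¬ Commute b a := by
  by_contra! hb
  exact h (Subgroup.mem_center_iff.2 fun b => hb b)

/-- Two noncentral elements have a common neighbour in the noncommuting graph. -/
theorem exists_not_commute_both {a b : G} (ha : a ∉ Subgroup.center G)
    (hb : b ∉ Subgroup.center G) : ∃ m, ¬ Commute m a ∧ ¬ Commute m b := by
  obtain ⟨x, hx⟩ := exists_not_commute ha
  obtain ⟨y, hy⟩ := exists_not_commute hb
  by_cases hxb : Commute x b
  · by_cases hya : Commute y a
    -- Here `x` fails to commute with `a` only, and `y` with `b` only.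
    · exact ⟨x * y, not_commute_mul_left hx hya, not_commute_mul_right hxb hy⟩
    · exact ⟨y, hya, hy⟩
  · exact ⟨x, hx, hxb⟩

/-- Equality or adjacency in the noncommuting graph. -/
def Near (a b : G) : Prop := a = b ∨ ¬ Commute a b

theorem Near.refl (a : G) : Near a a := .inl rfl

theorem Near.symm {a b : G} (h : Near a b) : Near b a :=
  h.imp Eq.symm fun h h' => h h'.symm

/-- The four vertices of an edge path of length three lie in the star of a single vertex. -/
theorem exists_near_path {a b c d : G} (hb : b ∉ Subgroup.center G) (hc : c ∉ Subgroup.center G)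
    (hab : Near a b) (hbc : Near b c) (hcd : Near c d) :
    ∃ p, p ∉ Subgroup.center G ∧ Near p a ∧ Near p b ∧ Near p c ∧ Near p d := by
  by_cases hbd : Near b d
  · exact ⟨b, hb, hab.symm, .refl b, hbc, hbd⟩
  by_cases hca : Near c a
  · exact ⟨c, hc, hca, hbc.symm, .refl c, hcd⟩
  have hab' : ¬ Commute b a := by
    rcases hab with rfl | h
    · exact absurd hbc.symm hca
    · exact fun h' => h h'.symm
  have hbc' : ¬ Commute b c := by
    rcases hbc with rfl | h
    · exact absurd hcd hbd
    · exact h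
  have hcd' : ¬ Commute c d := by
    rcases hcd with rfl | h
    · exact absurd hbc hbd
    · exact h
  simp only [Near, not_or, not_not] at hbd hca
  -- Now `b` commutes with `d` and `c` with `a`, so exactly one factor of `b * c` commutes with each
  -- of the four elements.
  have hpb : ¬ Commute (b * c) b :=
    not_commute_mul_right (.refl b) fun h => hbc' h.symm
  exact ⟨b * c, notMem_center_of_not_commute hpb, .inr (not_commute_mul_left hab' hca.2),
    .inr hpb, .inr (not_commute_mul_left hbc' (.refl c)),
    .inr (not_commute_mul_right hbd.2 hcd')⟩

theorem mem_faces_BNC {s : Finset G} : s ∈ (BNC G).faces ↔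
    s.Nonempty ∧ (∀ g ∈ s, g ∉ Subgroup.center G) ∧ ∀ g ∈ s, ∀ h ∈ s, Near g h := by
  constructor
  · rintro ⟨⟨hne, -, h⟩, hc⟩
    exact ⟨hne, hc, fun g hg k hk => or_iff_not_imp_left.2 (h g hg k hk)⟩
  · rintro ⟨hne, hc, h⟩
    refine ⟨⟨hne, ?_, fun g hg k hk hgk => (h g hg k hk).resolve_left hgk⟩, hc⟩
    rintro g hg rfl
    exact hc 1 hg (one_mem _)

theorem mem_vertexSet_BNC {g : G} : g ∈ vertexSet (BNC G) ↔ g ∉ Subgroup.center G := by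
  simp [vertexSet, mem_faces_BNC, Near.refl]

open Classical in
theorem triple_mem_faces_BNC {a b c : vertexSet (BNC G)} (hab : Near a.1 b.1)
    (hbc : Near b.1 c.1) (hac : Near a.1 c.1) : {a.1, b.1, c.1} ∈ (BNC G).faces := by
  have ha := mem_vertexSet_BNC.1 a.2
  have hb := mem_vertexSet_BNC.1 b.2
  have hc := mem_vertexSet_BNC.1 c.2
  simp [mem_faces_BNC, Near.refl, hab, hbc, hac, hab.symm, hbc.symm, hac.symm, ha, hb, hc]

theorem isSimplicialAction_BNC : IsSimplicialAction (ConjAct G) (BNC G) := by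
  intro h s hs
  rw [mem_faces_BNC] at hs ⊢
  obtain ⟨hne, hc, hn⟩ := hs
  have hcomm : ∀ g k : G, Commute (h • g) (h • k) → Commute g k := by
    intro g k hgk
    have := congrArg (h⁻¹ • ·) hgk.eq
    simpa [smul_mul', commute_iff_eq] using this
  refine ⟨hne.map, ?_, ?_⟩
  · intro g hg
    obtain ⟨k, hk, rfl⟩ := Finset.mem_map.1 hg
    intro hkc
    obtain ⟨y, hy⟩ := exists_not_commute (hc k hk)
    exact hy (hcomm _ _ (Subgroup.mem_center_iff.1 hkc (h • y)))
  · intro g hg g' hg'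
    obtain ⟨k, hk, rfl⟩ := Finset.mem_map.1 hg
    obtain ⟨k', hk', rfl⟩ := Finset.mem_map.1 hg'
    exact (hn k hk k' hk').imp (fun e => by rw [e]) fun e e' => e (hcomm _ _ e')

theorem exists_walk_length_le_two (v w : vertexSet (BNC G)) :
    ∃ p : (edgeGraph (BNC G)).Walk v w, p.length ≤ 2 := by
  classical
  obtain ⟨m, hmv, hmw⟩ :=
    exists_not_commute_both (mem_vertexSet_BNC.1 v.2) (mem_vertexSet_BNC.1 w.2)
  let m' : vertexSet (BNC G) := ⟨m, mem_vertexSet_BNC.2 (notMem_center_of_not_commute hmv)⟩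
  have adj : ∀ u : vertexSet (BNC G), ¬ Commute m u.1 → (edgeGraph (BNC G)).Adj m' u := by
    intro u hu
    refine ⟨?_, ?_⟩
    · rintro rfl
      exact hu (.refl m)
    -- A triple with a repeated vertex is the edge.
    · have := triple_mem_faces_BNC (a := m') (b := m') (c := u) (.refl m) (.inr hu) (.inr hu)
      simpa using this
  exact ⟨.cons (adj v hmv).symm (.cons (adj w hmw) .nil), le_rfl⟩

/-! ### Edge classes -/

theorem cofacial_of_near {a b : vertexSet (BNC G)} (h : Near a.1 b.1) :
    Cofacial (vertexPoint a) (vertexPoint b) := by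
  classical
  exact .of_mem_face (triple_mem_faces_BNC (.refl a.1) h h) (by simp) (by simp)

theorem near_of_cofacial {a b : vertexSet (BNC G)}
    (h : Cofacial (vertexPoint a) (vertexPoint b)) : Near a.1 b.1 := by
  obtain ⟨s, hs, ha, hb⟩ := h
  exact (mem_faces_BNC.1 hs).2.2 _ (mem_of_pos ha (vertexPoint_mem_openStar a)) _
    (mem_of_pos hb (vertexPoint_mem_openStar b))

/-- The homotopy class of the edge between two adjacent or equal vertices. -/
noncomputable def edgeClass {a b : vertexSet (BNC G)} (h : Near a.1 b.1) :
    Homotopic.Quotient (vertexPoint a) (vertexPoint b) :=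
  segmentClass (cofacial_of_near h)

theorem edgeClass_trans {a b c : vertexSet (BNC G)} (hab : Near a.1 b.1) (hbc : Near b.1 c.1)
    (hac : Near a.1 c.1) : (edgeClass hab).trans (edgeClass hbc) = edgeClass hac := by
  classical
  exact segmentClass_trans (triple_mem_faces_BNC hab hbc hac) (vertexPoint_mem (by simp))
    (vertexPoint_mem (by simp)) (vertexPoint_mem (by simp)) _ _ _

/-- Both triangles with apex `p` are filled by faces, possibly degenerate. -/
theorem edgeClass_trans_of_cone {a b c p : vertexSet (BNC G)} (hab : Near a.1 b.1)
    (hbc : Near b.1 c.1) (hpa : Near p.1 a.1) (hpb : Near p.1 b.1) (hpc : Near p.1 c.1) :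
    (edgeClass hab).trans (edgeClass hbc) = (edgeClass hpa.symm).trans (edgeClass hpc) := by
  rw [← edgeClass_trans hpa.symm hpb hab, Homotopic.Quotient.trans_assoc,
    edgeClass_trans hpb hbc hpc]

theorem exists_near_path_vertex {a b c d : vertexSet (BNC G)} (hab : Near a.1 b.1)
    (hbc : Near b.1 c.1) (hcd : Near c.1 d.1) : ∃ p : vertexSet (BNC G),
      Near p.1 a.1 ∧ Near p.1 b.1 ∧ Near p.1 c.1 ∧ Near p.1 d.1 := by
  obtain ⟨p, hp, h⟩ := exists_near_path (mem_vertexSet_BNC.1 b.2) (mem_vertexSet_BNC.1 c.2)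
    hab hbc hcd
  exact ⟨⟨p, mem_vertexSet_BNC.2 hp⟩, h⟩

theorem edgeClass_square {a b c d : vertexSet (BNC G)} (hab : Near a.1 b.1)
    (hbc : Near b.1 c.1) (had : Near a.1 d.1) (hdc : Near d.1 c.1) :
    (edgeClass hab).trans (edgeClass hbc) = (edgeClass had).trans (edgeClass hdc) := by
  -- The path `d, a, b, c` visits every corner of the square, so the whole square is coned off from
  -- `p`.
  obtain ⟨p, hpd, hpa, hpb, hpc⟩ := exists_near_path_vertex had.symm hab hbc
  rw [edgeClass_trans_of_cone hab hbc hpa hpb hpc, edgeClass_trans_of_cone had hdc hpa hpd hpc]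

theorem edgeClass_pentagon {a b c d e : vertexSet (BNC G)} (hab : Near a.1 b.1)
    (hbc : Near b.1 c.1) (hcd : Near c.1 d.1) (hae : Near a.1 e.1) (hed : Near e.1 d.1) :
    ((edgeClass hab).trans (edgeClass hbc)).trans (edgeClass hcd) =
      (edgeClass hae).trans (edgeClass hed) := by
  -- Coning `e, a, b, c` replaces `b` by `p`; what remains is the square `p, c, d, e` and the
  -- triangle `a, p, e`.
  obtain ⟨p, hpe, hpa, hpb, hpc⟩ := exists_near_path_vertex hae.symm hab hbc
  rw [edgeClass_trans_of_cone hab hbc hpa hpb hpc, Homotopic.Quotient.trans_assoc,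
    edgeClass_square hpc hcd hpe hed, ← Homotopic.Quotient.trans_assoc,
    edgeClass_trans hpa.symm hpe hae]

theorem simplyConnectedSpace_BNC (hG : ∃ a b : G, a * b ≠ b * a) :
    SimplyConnectedSpace (Realization (BNC G)) := by
  obtain ⟨a, b, hab⟩ := hG
  have ha : a ∉ Subgroup.center G := notMem_center_of_not_commute hab
  let o : vertexSet (BNC G) := ⟨a, mem_vertexSet_BNC.2 ha⟩
  have hm : ∀ v : vertexSet (BNC G), ∃ m : vertexSet (BNC G), Near o.1 m.1 ∧ Near m.1 v.1 := by
    intro v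
    obtain ⟨m, hmo, hmv⟩ := exists_not_commute_both ha (mem_vertexSet_BNC.1 v.2)
    exact ⟨⟨m, mem_vertexSet_BNC.2 (notMem_center_of_not_commute hmo)⟩, Near.symm (.inr hmo),
      .inr hmv⟩
  choose m hom hmv using hm
  exact simplyConnectedSpace_of_classes (vertexPoint o)
    (fun v => (edgeClass (hom v)).trans (edgeClass (hmv v)))
    fun v w h => edgeClass_pentagon (hom v) (hmv v) (near_of_cofacial h) (hom w) (hmv w)

end NonCommutingGroups

end NonCommuting

theorem mainTheorem3 (G : Type*) [Group G] (hG : ∃ a b : G, a * b ≠ b * a) :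
    -- conjugation makes `BNC(G)` a `G`-simplicial complex
    NonCommuting.IsSimplicialAction (ConjAct G) (NonCommuting.BNC G) ∧
    -- any two vertices are joined by an edge path with at most two edges
    (∀ v w : NonCommuting.vertexSet (NonCommuting.BNC G),
      ∃ p : (NonCommuting.edgeGraph (NonCommuting.BNC G)).Walk v w, p.length ≤ 2) ∧
    PathConnectedSpace (NonCommuting.Realization (NonCommuting.BNC G)) ∧
    SimplyConnectedSpace (NonCommuting.Realization (NonCommuting.BNC G)) := by
  have hsc := NonCommuting.simplyConnectedSpace_BNC hG
  exact ⟨NonCommuting.isSimplicialAction_BNC, NonCommuting.exists_walk_length_le_two,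
    inferInstance, hsc⟩
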